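/- **Conventions.** $\mathbb N=\{0,1,2,\dots\}$. For $M\subseteq\mathbb N$ and a finite $u\subset\mathbb N$ put $M/u=\{n\in M:\ i<n\text{ for all }i\in u\}$ and $M/n=M/\{n\}$. For a family $\mathcal F$ of finite subsets of $\mathbb N$ put $\mathcal F\upharpoonright M=\{s\in\mathcal F: s\subseteq M\}$ and $\mathcal F_u=\{s \text{ finite}: u\cup s\in\mathcal F,\ i<j \text{ for all } i\in u,\ j\in s\}$. Write $s<_{lex}t$ iff $\min(s\triangle t)\in s$. **Uniform families.** Let $S\subseteq\mathbb N$ be infinite. The only $0$-uniform family on $S$ is $\{\emptyset\}$. For $\alpha>0$, a family $\mathcal F$ of nonempty finite subsets of $S$ is $\alpha$-uniform on $S$ if either $\alpha=\beta+1$ and $\mathcal F_{\{n\}}$ is $\beta$-uniform on $S/n$ for every $n\in S$; or $\alpha$ is a limit ordinal and there is a strictly increasing sequence of ordinals $(\alpha_n)_{n\in S}$ with supremum $\alpha$ such that $\mathcal F_{\{n\}}$ is $\alpha_n$-uniform on $S/n$ for every $n\in S$. If $\mathcal F$ is uniform on a final segment $S$ of $\mathbb N$ and $n\in S$, let $t_n^{\mathcal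 F}$ be the unique element of $\mathcal F$ that is an initial segment of $\{n,n+1,n+2,\dots\}$. **Adequate sets.** Let $\mathcal F$ be $\alpha$-uniform on a final segment $S$ of $\mathbb N$, $\alpha\ge 2$, and let $M\subseteq S$ be infinite. The set $M(\mathcal F)\subseteq M$ and the notion "$M$ is $\mathcal F$-adequate" are defined by recursion on $\alpha$: * if $\alpha=2$, then $M(\mathcal F)=\{n\in M: t_{n+1}^{\mathcal F}\subseteq M\}$, and $M$ is $\mathcal F$-adequate iff $M(\mathcal F)\ne\emptyset$; * if $\alpha=\beta+1$ with $\beta\ge2$, then $M(\mathcal F)$ is the set of $n\in M$ such that $t_{n+1}^{\mathcal F}\subseteq M$, $M/n$ is $\mathcal F_{\{n\}}$-adequate and $(M/n)(\mathcal F_{\{n\}})$ is infinite; $M$ is $\mathcal F$-adequate iff $M(\mathcal F)\neq\emptyset$; * if $\alpha$ is a limit ordinal, then $M(\mathcal F)=M$, and, with $(\alpha_n)_{n\in S}$ the sequence from the definition of an $\alpha$-uniform family, $M$ is $\mathcal F$-adequate iff for every $n\in S$ there is a nonempty finite $v\subset M$ such that, for some $\gamma\ge\alpha_n$ with $\gamma\geq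 2$, $\mathcal F_v$ is $\gamma$-uniform on $S/v$ and $M/v$ is $\mathcal F_v$-adequate (necessarily $\gamma<\alpha$). **Cantor–Bendixson index.** For a subset $A$ of a topological space, $A'$ is the set of points of $A$ that are limit points of $A$; $A^{(0)}=A$, $A^{(\delta+1)}=(A^{(\delta)})'$, and $A^{(\delta)}=\bigcap_{\varepsilon<\delta}A^{(\varepsilon)}$ for limit $\delta$. The CB index of $A$ is the least $\delta$ with $A^{(\delta)}=A^{(\delta+1)}$. **Theorem.** Let $\mathcal F$ be an $\alpha$-uniform family on a final segment $S$ of $\mathbb N$ with $\alpha\ge2$, endowed with the order topology of $<_{lex}$, and let $M\subseteq S$ be an infinite $\mathcal F$-adequate set. Then the CB index of $\mathcal F\upharpoonright M$, as a subspace of $\mathcal F$, is exactly $\alpha$. Moreover, if $\alpha=\beta+1$, then $t_{n+1}^{\mathcal F}\in(\mathcal F\upharpoonright M)^{(\beta)}$ for every $n\in M(\mathcal F)$. -/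

import Mathlib

/-- The tail `M / u` of the members of `M` above every element of `u`; it is `M` when `u = ∅`. -/
def tailAfter (M : Set ℕ) (u : Finset ℕ) : Set ℕ :=
  {n | n ∈ M ∧ ∀ i ∈ u, i < n}

/-- The family `F_u` of all finite `s` with `max u < min s` and `u ∪ s ∈ F`
(`∅` counts as lying above every `u`). -/
def familyAt (F : Set (Finset ℕ)) (u : Finset ℕ) : Set (Finset ℕ) :=
  {s | u ∪ s ∈ F ∧ ∀ i ∈ u, ∀ j ∈ s, i < j}

/-- `IsUniform α S F`: the family `F` of finite subsets of the infinite set `S` is `α`-uniform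
on `S`. -/
inductive IsUniform : Ordinal.{0} → Set ℕ → Set (Finset ℕ) → Prop
  | zero {S : Set ℕ} (hS : S.Infinite) : IsUniform 0 S {∅}
  | succ {α : Ordinal.{0}} {S : Set ℕ} {F : Set (Finset ℕ)} (hS : S.Infinite)
      (hF : ∀ s ∈ F, s.Nonempty ∧ (s : Set ℕ) ⊆ S)
      (h : ∀ n ∈ S, IsUniform α (tailAfter S {n}) (familyAt F {n})) :
      IsUniform (α + 1) S F
  | limit {α : Ordinal.{0}} {S : Set ℕ} {F : Set (Finset ℕ)} (hS : S.Infinite)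
      (hF : ∀ s ∈ F, s.Nonempty ∧ (s : Set ℕ) ⊆ S)
      (hα : Order.IsSuccLimit α) (a : ℕ → Ordinal.{0})
      (ha : StrictMonoOn a S) (hlub : IsLUB (a '' S) α)
      (h : ∀ n ∈ S, IsUniform (a n) (tailAfter S {n}) (familyAt F {n})) :
      IsUniform α S F

/-- The finite set `s` is an initial segment of `A`. -/
def IsInitialSegment (s : Finset ℕ) (A : Set ℕ) : Prop :=
  ∃ k : ℕ, (s : Set ℕ) = A ∩ Set.Iic k

/-- `t_n^F`, the element of `F` that is an initial segment of `{n, n + 1, …}`. It exists and is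
unique when `F` is uniform on a final segment of `ℕ` that contains `n`. -/
noncomputable def firstBlock (F : Set (Finset ℕ)) (n : ℕ) : Finset ℕ :=
  Classical.epsilon fun t => t ∈ F ∧ IsInitialSegment t (Set.Ici n)

mutual

/-- The set `M(F)`, for `F` an `α`-uniform family on `S` with `2 ≤ α` and `M ⊆ S` infinite.
The three alternatives are: `α = 2`; `α = β + 1` with `2 ≤ β`; `α` a limit ordinal. -/
def adequateCore (α : Ordinal.{0}) (S : Set ℕ) (F : Set (Finset ℕ)) (M : Set ℕ) : Set ℕ :=
  {n | n ∈ M ∧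
    ((α = 2 ∧ (firstBlock F (n + 1) : Set ℕ) ⊆ M) ∨
     (∃ (β : Ordinal.{0}) (_ : α = β + 1), 2 ≤ β ∧
        (firstBlock F (n + 1) : Set ℕ) ⊆ M ∧
        IsAdequate β (tailAfter S {n}) (familyAt F {n}) (tailAfter M {n}) ∧
        (adequateCore β (tailAfter S {n}) (familyAt F {n}) (tailAfter M {n})).Infinite) ∨
     Order.IsSuccLimit α)}
termination_by (α, 0)
decreasing_by
  all_goals
    subst_vars
    exact Prod.Lex.left _ _ (Order.lt_add_one_iff.mpr le_rfl)

/-- `M` is `F`-adequate, for `F` an `α`-uniform family on `S` with `2 ≤ α` and `M ⊆ S` infinite.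
For `α` a limit, `a` is the sequence of ordinals that witnesses the `α`-uniformity of `F` (it is
determined by `F` on `S`). The bound `γ < α` holds automatically for `v ≠ ∅`; it is written out
because the recursion is on the ordinal. -/
def IsAdequate (α : Ordinal.{0}) (S : Set ℕ) (F : Set (Finset ℕ)) (M : Set ℕ) : Prop :=
  ((∃ β : Ordinal.{0}, α = β + 1 ∧ 2 ≤ α) ∧ (adequateCore α S F M).Nonempty) ∨
  (Order.IsSuccLimit α ∧
    ∃ a : ℕ → Ordinal.{0}, StrictMonoOn a S ∧ IsLUB (a '' S) α ∧
      (∀ n ∈ S, IsUniform (a n) (tailAfter S {n}) (familyAt F {n})) ∧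
      ∀ n ∈ S, ∃ v : Finset ℕ, v.Nonempty ∧ (v : Set ℕ) ⊆ M ∧
        ∃ (γ : Ordinal.{0}) (_ : γ < α), a n ≤ γ ∧ 2 ≤ γ ∧
          IsUniform γ (tailAfter S v) (familyAt F v) ∧
          IsAdequate γ (tailAfter S v) (familyAt F v) (tailAfter M v))
termination_by (α, 1)
decreasing_by
  · exact Prod.Lex.right _ Nat.zero_lt_one
  · exact Prod.Lex.left _ _ (by assumption)

end

/-- The lexicographic order: `s <_lex t` iff the least element of the symmetric difference of `s`
and `t` belongs to `s`. -/
def LexLT (s t : Finset ℕ) : Prop :=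
  ∃ m, m ∈ s ∧ m ∉ t ∧ ∀ i < m, (i ∈ s ↔ i ∈ t)

/-- The family `F` as a type, to carry the lexicographic order topology. -/
def LexFamily (F : Set (Finset ℕ)) : Type := {s : Finset ℕ // s ∈ F}

/-- The order topology of `<_lex` on `F`, generated by the open rays. -/
instance LexFamily.instTopologicalSpace (F : Set (Finset ℕ)) : TopologicalSpace (LexFamily F) :=
  TopologicalSpace.generateFrom
    {U | ∃ a : LexFamily F, U = {x | LexLT a.1 x.1} ∨ U = {x | LexLT x.1 a.1}}

/-- `F ↾ M`, the members of `F` contained in `M`, as a subset of the space `F`. -/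
def familyRestrict (F : Set (Finset ℕ)) (M : Set ℕ) : Set (LexFamily F) :=
  {s | (s.1 : Set ℕ) ⊆ M}

/-- `α` is the Cantor–Bendixson index of `A`: the least `δ` with `A^(δ) = A^(δ+1)`, where
`A' = derivedSet A ∩ A` consists of the points of `A` that are limit points of `A`. -/
def IsCBIndex {X : Type} [TopologicalSpace X] (A : Set X) (α : Ordinal.{0}) : Prop :=
  IsLeast {δ : Ordinal.{0} | CantorBendixson.iteratedDerivedSet A δ =
    CantorBendixson.iteratedDerivedSet A (δ + 1)} α

-- In the lexicographic order, `F` is the concatenation over `n ∈ S` of the blocks `{n} ∪ F_{n}`,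
-- and `t_n` is the first point of the `n`-th block. Everything is an induction on the rank along
-- these blocks.
--
-- Upper bound: already `F^(α) = ∅`, and derivatives are monotone in the set. The open interval
-- `(t_n, t_{n+1})` lies inside block `n`, so there derivatives are computed in `F_{n}`. By
-- induction only `t_n` can survive in block `n` to stage `a n`, the rank of `F_{n}`. Hence only
-- finitely many points of `F^(a n)` lie below `t_{n+1}`, and no point starting with `n` reaches
-- stage `a n + 1 ≤ α`.
--
-- Lower bound: `t_{n+1}` is the limit of members starting with `n` whose second element tends to
-- infinity. If `α = β + 1`, adequacy supplies, for each `δ < β`, such members inside `M` in the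
-- `δ`-th derivative, so `t_{n+1}` survives to stage `β`. If `α` is a limit, adequacy supplies
-- sections `F_v` of rank cofinal in `α`, and their derivatives embed into those of `F ↾ M`.

-- Uniform families: initial segments and ranks of sections

theorem IsUniform.infinite {α : Ordinal.{0}} {S : Set ℕ} {F : Set (Finset ℕ)}
    (h : IsUniform α S F) : S.Infinite := by
  cases h <;> assumption

/-- A uniform family of positive rank splits into its sections at the singletons. -/
theorem IsUniform.eq_zero_or_sections {α : Ordinal.{0}} {S : Set ℕ} {F : Set (Finset ℕ)}
    (h : IsUniform α S F) :
    (α = 0 ∧ F = {∅}) ∨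
      ((∀ s ∈ F, s.Nonempty ∧ (s : Set ℕ) ⊆ S) ∧ ∃ a : ℕ → Ordinal.{0},
        (∀ n ∈ S, IsUniform (a n) (tailAfter S {n}) (familyAt F {n})) ∧
        MonotoneOn a S ∧ (∀ n ∈ S, a n < α) ∧
        ((Order.IsSuccLimit α ∧ StrictMonoOn a S ∧ IsLUB (a '' S) α) ∨
          ∃ β, α = β + 1 ∧ ∀ n, a n = β)) := by
  cases h with
  | zero hS => exact Or.inl ⟨rfl, rfl⟩
  | @succ β _ _ hS hF h =>
    exact Or.inr ⟨hF, fun _ => β, h, monotoneOn_const, fun _ _ => Order.lt_add_one_iff.mpr le_rfl,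
      Or.inr ⟨β, rfl, fun _ => rfl⟩⟩
  | limit hS hF hα a ha hlub h =>
    refine Or.inr ⟨hF, a, h, ha.monotoneOn, fun n hn => ?_, Or.inl ⟨hα, ha, hlub⟩⟩
    obtain ⟨m, hm, hnm⟩ := hS.exists_gt n
    exact (ha hn hm hnm).trans_le (hlub.1 ⟨m, hm, rfl⟩)

theorem IsUniform.section_of_add_one {β : Ordinal.{0}} {S : Set ℕ} {F : Set (Finset ℕ)}
    (h : IsUniform (β + 1) S F) {n : ℕ} (hn : n ∈ S) :
    IsUniform β (tailAfter S {n}) (familyAt F {n}) := by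
  rcases h.eq_zero_or_sections with ⟨h0, -⟩ | ⟨-, a, ha, -, -, ⟨hl, -⟩ | ⟨γ, hγ, haγ⟩⟩
  · simp at h0
  · exact absurd hl (Order.not_isSuccLimit_add_one β)
  · have : β = γ := by simpa using hγ
    rw [this, ← haγ n]
    exact ha n hn

theorem IsUniform.nonempty_and_subset {α : Ordinal.{0}} {S : Set ℕ} {F : Set (Finset ℕ)}
    (h : IsUniform α S F) (hα : α ≠ 0) {s : Finset ℕ} (hs : s ∈ F) :
    s.Nonempty ∧ (s : Set ℕ) ⊆ S := by
  rcases h.eq_zero_or_sections with ⟨h0, -⟩ | ⟨hF, -⟩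
  · exact absurd h0 hα
  · exact hF s hs

theorem mem_familyAt_singleton_erase {F : Set (Finset ℕ)} {s : Finset ℕ} (hs : s ∈ F) {n : ℕ}
    (hn : n ∈ s) (hmin : ∀ i ∈ s, n ≤ i) : s.erase n ∈ familyAt F {n} := by
  refine ⟨?_, ?_⟩
  · rwa [← Finset.insert_eq, Finset.insert_erase hn]
  · simp only [Finset.mem_singleton, Finset.mem_erase]
    rintro _ rfl j ⟨hj, hjs⟩
    exact lt_of_le_of_ne (hmin j hjs) (Ne.symm hj)

/-- Every infinite subset of the base set has an initial segment in the family. -/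
theorem IsUniform.exists_initial {α : Ordinal.{0}} {S : Set ℕ} {F : Set (Finset ℕ)}
    (h : IsUniform α S F) {X : Set ℕ} (hX : X.Infinite) (hXS : X ⊆ S) :
    ∃ t ∈ F, ∃ k, (t : Set ℕ) = X ∩ Set.Iio k := by
  induction α using WellFoundedLT.induction generalizing S F X with
  | _ α ih =>
    rcases h.eq_zero_or_sections with ⟨-, rfl⟩ | ⟨-, a, ha, -, hlt, -⟩
    · exact ⟨∅, rfl, 0, by ext; simp⟩
    · have hne := hX.nonempty
      have hn : sInf X ∈ X := Nat.sInf_mem hne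
      set n := sInf X with hndef
      have hmin : ∀ i ∈ X, n ≤ i := fun i hi => Nat.sInf_le hi
      have hinf : (X \ {n}).Infinite := hX.sdiff (Set.finite_singleton n)
      obtain ⟨t, ht, k, hk⟩ := ih (a n) (hlt n (hXS hn)) (ha n (hXS hn)) hinf (by
        rintro i ⟨hi, hin⟩
        refine ⟨hXS hi, ?_⟩
        simpa using lt_of_le_of_ne (hmin i hi) (Ne.symm hin))
      -- If `t = ∅` the bound `k` may be at most `n`; the maximum keeps `n` inside the segment.
      refine ⟨{n} ∪ t, ht.1, max k (n + 1), ?_⟩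
      ext i
      have hki := Set.ext_iff.mp hk i
      have := hmin i
      simp only [Finset.mem_coe, Set.mem_inter_iff, Set.mem_sdiff, Set.mem_singleton_iff,
        Set.mem_Iio] at hki
      simp only [Finset.coe_union, Finset.coe_singleton, Set.singleton_union, Set.mem_insert_iff,
        Finset.mem_coe, Set.mem_inter_iff, Set.mem_Iio, lt_max_iff, hki]
      constructor
      · rintro (rfl | ⟨⟨h1, -⟩, h2⟩)
        · exact ⟨hn, Or.inr (Nat.lt_succ_self _)⟩
        · exact ⟨h1, Or.inl h2⟩
      · rintro ⟨h1, h2⟩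
        have := hmin i h1
        by_cases hin : i = n
        · exact Or.inl hin
        · exact Or.inr ⟨⟨h1, hin⟩, by omega⟩

/-- No member of a uniform family is a proper initial segment of another one. -/
theorem IsUniform.eq_of_initial {α : Ordinal.{0}} {S : Set ℕ} {F : Set (Finset ℕ)}
    (h : IsUniform α S F) {s t : Finset ℕ} (hs : s ∈ F) (ht : t ∈ F) {k : ℕ}
    (hk : ∀ i, i ∈ s ↔ i ∈ t ∧ i < k) : s = t := by
  induction α using WellFoundedLT.induction generalizing S F s t with
  | _ α ih =>
    rcases h.eq_zero_or_sections with ⟨-, rfl⟩ | ⟨hF, a, ha, -, hlt, -⟩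
    · exact hs.trans ht.symm
    · obtain ⟨hne, hsS⟩ := hF s hs
      have hmin : ∀ i ∈ s, s.min' hne ≤ i := fun i hi => s.min'_le i hi
      have hn : s.min' hne ∈ s := s.min'_mem hne
      set n := s.min' hne
      have hnt := (hk n).mp hn
      have hmint : ∀ i ∈ t, n ≤ i := by
        intro i hi
        by_contra! hlt'
        exact absurd (hmin i ((hk i).mpr ⟨hi, hlt'.trans hnt.2⟩)) (not_le.mpr hlt')
      have := ih (a n) (hlt n (hsS hn)) (ha n (hsS hn)) (mem_familyAt_singleton_erase hs hn hmin)
        (mem_familyAt_singleton_erase ht hnt.1 hmint) (by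
          intro i
          simp only [Finset.mem_erase, hk i, and_assoc])
      rw [← Finset.insert_erase hn, this, Finset.insert_erase hnt.1]

theorem tailAfter_empty (S : Set ℕ) : tailAfter S ∅ = S := by
  ext; simp [tailAfter]

theorem familyAt_empty (F : Set (Finset ℕ)) : familyAt F ∅ = F := by
  ext; simp [familyAt]

theorem tailAfter_tailAfter_singleton (S : Set ℕ) (k : ℕ) (v : Finset ℕ) :
    tailAfter (tailAfter S {k}) v = tailAfter S (insert k v) := by
  ext; simp [tailAfter, and_assoc]

theorem familyAt_familyAt_singleton (F : Set (Finset ℕ)) {k : ℕ} {v : Finset ℕ}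
    (hk : ∀ i ∈ v, k < i) :
    familyAt (familyAt F {k}) v = familyAt F (insert k v) := by
  ext s
  simp only [familyAt, Set.mem_ofPred_eq, Finset.mem_singleton, forall_eq, Finset.mem_union,
    forall_eq_or_imp, Finset.insert_eq, Finset.union_assoc]
  constructor
  · rintro ⟨⟨h1, h2⟩, h3⟩
    exact ⟨h1, fun j hj => h2 j (Or.inr hj), h3⟩
  · rintro ⟨h1, h2, h3⟩
    exact ⟨⟨h1, fun j hj => hj.elim (hk j) (h2 j)⟩, h3⟩

/-- The rank of a uniform family is determined by the family. -/
theorem IsUniform.rank_unique {α γ : Ordinal.{0}} {S : Set ℕ} {F : Set (Finset ℕ)}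
    (h : IsUniform α S F) (h' : IsUniform γ S F) : α = γ := by
  induction α using WellFoundedLT.induction generalizing γ S F with
  | _ α ih =>
    obtain ⟨t, ht, -⟩ := h.exists_initial h.infinite subset_rfl
    rcases h.eq_zero_or_sections with ⟨h0, hF0⟩ | ⟨hF, a, ha, -, hlt, hα⟩ <;>
    rcases h'.eq_zero_or_sections with ⟨h0', hF0'⟩ | ⟨hF', b, hb, -, -, hγ⟩
    · rw [h0, h0']
    · exact absurd (hF' ∅ (by rw [hF0]; rfl)).1 (by simp)
    · exact absurd (hF ∅ (by rw [hF0']; rfl)).1 (by simp)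
    · have hab : ∀ n ∈ S, a n = b n := fun n hn => ih (a n) (hlt n hn) (ha n hn) (hb n hn)
      -- This separates limit from successor ranks: the section ranks strictly increase in one case
      -- and are constant in the other.
      have hconst : ∀ c : ℕ → Ordinal.{0}, StrictMonoOn c S → ∀ β, ¬ ∀ n ∈ S, c n = β := by
        intro c hc β hβ
        obtain ⟨m, hm⟩ := h.infinite.nonempty
        obtain ⟨n, hn, hmn⟩ := h.infinite.exists_gt m
        exact (hc hm hn hmn).ne ((hβ m hm).trans (hβ n hn).symm)
      rcases hα with ⟨-, hsa, hla⟩ | ⟨β, rfl, haβ⟩ <;>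
      rcases hγ with ⟨-, hsb, hlb⟩ | ⟨δ, rfl, hbδ⟩
      · rw [Set.image_congr hab] at hla
        exact hla.unique hlb
      · exact absurd (fun n hn => (hab n hn).trans (hbδ n)) (hconst a hsa δ)
      · exact absurd (fun n hn => (hab n hn).symm.trans (haβ n)) (hconst b hsb β)
      · obtain ⟨m, hm⟩ := h.infinite.nonempty
        rw [← haβ m, ← hbδ m, hab m hm]

/-- Removing the elements of `v` one at a time from the least, each passage to a section lowers the
rank. -/
theorem IsUniform.rank_familyAt_le {α γ : Ordinal.{0}} {S : Set ℕ} {F : Set (Finset ℕ)}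
    (h : IsUniform α S F) {v : Finset ℕ} (hv : (v : Set ℕ) ⊆ S)
    (hγ : IsUniform γ (tailAfter S v) (familyAt F v)) : γ ≤ α := by
  induction v using Finset.induction_on_min generalizing α S F with
  | empty =>
    rw [tailAfter_empty, familyAt_empty] at hγ
    exact (hγ.rank_unique h).le
  | insert k v hk ih =>
    have hkS : k ∈ S := hv (by simp)
    obtain ⟨t, ht, -⟩ := hγ.exists_initial hγ.infinite subset_rfl
    rcases h.eq_zero_or_sections with ⟨-, rfl⟩ | ⟨-, a, ha, -, hlt, -⟩
    · exact absurd ht.1 (by simp)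
    · rw [← tailAfter_tailAfter_singleton, ← familyAt_familyAt_singleton F hk] at hγ
      refine (ih (ha k hkS) (fun i hi => ⟨hv (by simp_all), ?_⟩) hγ).trans (hlt k hkS).le
      simpa using hk i hi

/-- If `F_v` has rank at least the rank `a m` of `F_{m}`, then `v` lies in `[m, ∞)`. -/
theorem le_of_rank_familyAt {S : Set ℕ} {F : Set (Finset ℕ)} {a : ℕ → Ordinal.{0}}
    (hmono : StrictMonoOn a S)
    (ha : ∀ n ∈ S, IsUniform (a n) (tailAfter S {n}) (familyAt F {n})) {v : Finset ℕ}
    (hv : (v : Set ℕ) ⊆ S) {γ : Ordinal.{0}}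
    (hγ : IsUniform γ (tailAfter S v) (familyAt F v)) {m : ℕ} (hm : m ∈ S) (hle : a m ≤ γ) :
    ∀ j ∈ v, m ≤ j := by
  induction v using Finset.induction_on_min with
  | empty => simp
  | insert k v hk _ =>
    have hkS : k ∈ S := hv (by simp)
    rw [← tailAfter_tailAfter_singleton, ← familyAt_familyAt_singleton F hk] at hγ
    -- With `k` the least element of the whole set, the section is one of `F_{k}`, so `a m ≤ γ ≤ a
    -- k`, and strict monotonicity gives `m ≤ k`.
    have h1 := (ha k hkS).rank_familyAt_le (v := v)
      (fun i hi => ⟨hv (by simp_all), by simpa using hk i hi⟩) hγ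
    have h2 : m ≤ k := (hmono.le_iff_le hm hkS).mp (hle.trans h1)
    intro j hj
    rcases Finset.mem_insert.mp hj with rfl | hj
    · exact h2
    · exact h2.trans (hk j hj).le

-- Cantor–Bendixson derivatives: maps, locality, index

namespace CantorBendixson

universe u

variable {X Y : Type u} [TopologicalSpace X] [TopologicalSpace Y]

theorem mapsTo_iteratedDerivedSet {f : X → Y} (hf : Continuous f)
    (hinj : Function.Injective f) {A : Set X} {B : Set Y} (hAB : Set.MapsTo f A B)
    (δ : Ordinal) :
    Set.MapsTo f (iteratedDerivedSet A δ) (iteratedDerivedSet B δ) := by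
  induction δ using Ordinal.limitRecOn with
  | zero => simpa using hAB
  | add_one δ ih =>
    rintro x hx
    rw [iteratedDerivedSet_succ] at hx ⊢
    exact ⟨derivedSet_mono _ _ ih.image_subset (hf.image_derivedSet hinj ⟨x, hx.1, rfl⟩), ih hx.2⟩
  | limit δ hδ ih =>
    intro x hx
    rw [iteratedDerivedSet_limit hδ, Set.mem_iInter] at hx ⊢
    exact fun ε => ih ε ε.2 (hx ε)

/-- Being a limit point is local, and over an open set inside its range an embedding is a local
homeomorphism. -/
theorem mem_iteratedDerivedSet_of_isEmbedding {f : X → Y} (hf : Topology.IsEmbedding f)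
    {W : Set Y} (hW : IsOpen W) (hWf : W ⊆ Set.range f) {A : Set X} {B : Set Y}
    (hAB : f ⁻¹' B ⊆ A) {δ : Ordinal} {x : X} (hxW : f x ∈ W)
    (hx : f x ∈ iteratedDerivedSet B δ) : x ∈ iteratedDerivedSet A δ := by
  induction δ using Ordinal.limitRecOn generalizing x with
  | zero =>
    rw [iteratedDerivedSet_zero] at hx ⊢
    exact hAB hx
  | add_one δ ih =>
    rw [iteratedDerivedSet_succ] at hx ⊢
    refine ⟨?_, ih hxW hx.2⟩
    have hx1 := hx.1
    have hWx : W ∈ nhds (f x) := hW.mem_nhds hxW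
    rw [mem_derivedSet, accPt_iff_frequently] at hx1 ⊢
    have := hx1.and_eventually hWx
    rw [← hf.map_nhds_of_mem x (Filter.mem_of_superset hWx hWf), Filter.frequently_map] at this
    exact this.mono fun y hy => ⟨fun h => hy.1.1 (h ▸ rfl), ih hy.2 hy.1.2⟩
  | limit δ hδ ih =>
    rw [iteratedDerivedSet_limit hδ, Set.mem_iInter] at hx ⊢
    exact fun ε => ih ε ε.2 hxW (hx ε)

/-- Treats successor and limit stages alike when `t_{n+1}` is shown to survive. -/
theorem mem_iteratedDerivedSet_of_forall_lt {A : Set X} {x : X} (hx : x ∈ A) {δ : Ordinal}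
    (h : ∀ ε < δ, x ∈ derivedSet (iteratedDerivedSet A ε)) : x ∈ iteratedDerivedSet A δ := by
  induction δ using Ordinal.limitRecOn with
  | zero => simpa
  | add_one δ ih =>
    rw [iteratedDerivedSet_succ]
    exact ⟨h δ (Order.lt_add_one_iff.mpr le_rfl),
      ih fun ε hε => h ε (hε.trans (Order.lt_add_one_iff.mpr le_rfl))⟩
  | limit δ hδ ih =>
    rw [iteratedDerivedSet_limit hδ, Set.mem_iInter]
    exact fun ε => ih ε ε.2 fun ζ hζ => h ζ (hζ.trans ε.2)

end CantorBendixson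

/-- A derivative that repeats at a stage `δ < α` is the perfect kernel, hence contained in the empty
`α`-th derivative. -/
theorem isCBIndex_of_nonempty_of_eq_empty {X : Type} [TopologicalSpace X] {A : Set X}
    {α : Ordinal.{0}} (hne : ∀ δ < α, (CantorBendixson.iteratedDerivedSet A δ).Nonempty)
    (hempty : CantorBendixson.iteratedDerivedSet A α = ∅) : IsCBIndex A α := by
  refine ⟨?_, fun δ hδ => ?_⟩
  · rw [Set.mem_ofPred_eq, CantorBendixson.iteratedDerivedSet_succ, hempty]
    exact (Set.subset_empty_iff.mp relDerivedSet_subset).symm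
  · by_contra! hlt
    have h1 := CantorBendixson.perfectKernel_eq_iteratedDerivedSet_of_mem_fixedPoints
      (CantorBendixson.mem_fixedPoints_of_iteratedDerivedSet_succ_eq (s := A) hδ.symm)
    have h2 := CantorBendixson.perfectKernel_subset_iteratedDerivedSet A α
    rw [h1, hempty, Set.subset_empty_iff] at h2
    exact (hne δ hlt).ne_empty h2

-- The lexicographic order on finite sets

theorem LexLT.irrefl (s : Finset ℕ) : ¬ LexLT s s := fun ⟨_, h, h', _⟩ => h' h

theorem LexLT.trans {s t u : Finset ℕ} (h : LexLT s t) (h' : LexLT t u) : LexLT s u := by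
  obtain ⟨m, hm, hm', hlt⟩ := h
  obtain ⟨k, hk, hk', hlt'⟩ := h'
  rcases lt_trichotomy m k with hmk | rfl | hmk
  · exact ⟨m, hm, fun h => hm' ((hlt' m hmk).mpr h),
      fun i hi => (hlt i hi).trans (hlt' i (hi.trans hmk))⟩
  · exact absurd hk hm'
  · exact ⟨k, (hlt k hmk).mpr hk, hk', fun i hi => (hlt i (hi.trans hmk)).trans (hlt' i hi)⟩

theorem LexLT.lt_or_lt {s t : Finset ℕ} (h : s ≠ t) : LexLT s t ∨ LexLT t s := by
  have hex : ∃ i, ¬ (i ∈ s ↔ i ∈ t) := by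
    by_contra! hall
    exact h (Finset.ext hall)
  classical
  have hspec := Nat.find_spec hex
  have hmin : ∀ i < Nat.find hex, (i ∈ s ↔ i ∈ t) := fun i hi => not_not.mp (Nat.find_min hex hi)
  by_cases hs : Nat.find hex ∈ s
  · exact Or.inl ⟨_, hs, fun ht => hspec ⟨fun _ => ht, fun _ => hs⟩, hmin⟩
  · exact Or.inr ⟨_, by tauto, hs, fun i hi => (hmin i hi).symm⟩

theorem LexLT.union_left_iff {v s t : Finset ℕ} (hs : ∀ i ∈ v, ∀ j ∈ s, i < j)
    (ht : ∀ i ∈ v, ∀ j ∈ t, i < j) : LexLT (v ∪ s) (v ∪ t) ↔ LexLT s t := by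
  simp only [LexLT, Finset.mem_union]
  refine exists_congr fun m => ?_
  constructor
  · rintro ⟨h1, h2, h3⟩
    rw [not_or] at h2
    have h1 := h1.resolve_left h2.1
    refine ⟨h1, h2.2, fun i hi => ?_⟩
    have := h3 i hi
    have hiv : i ∈ v → i ∉ s ∧ i ∉ t :=
      fun hv => ⟨fun h => (hs i hv i h).false, fun h => (ht i hv i h).false⟩
    tauto
  · rintro ⟨h1, h2, h3⟩
    exact ⟨Or.inr h1, not_or.mpr ⟨fun hv => (hs m hv m h1).false, h2⟩,
      fun i hi => or_congr_right (h3 i hi)⟩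

/-- A set that does not extend `v` compares in the same way with all extensions of `v`. -/
theorem LexLT.compare_extensions {v a : Finset ℕ}
    (ha : ¬ ∃ s, (∀ i ∈ v, ∀ j ∈ s, i < j) ∧ a = v ∪ s) :
    (∀ s : Finset ℕ, (∀ i ∈ v, ∀ j ∈ s, i < j) → LexLT a (v ∪ s)) ∨
      ∀ s : Finset ℕ, (∀ i ∈ v, ∀ j ∈ s, i < j) → LexLT (v ∪ s) a := by
  -- If `a` and `v` agreed up to `max v`, then `a` would extend `v`. The first disagreement decides
  -- the comparison, since extensions of `v` agree with `v` that far.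
  have hex : ∃ i, (∃ j ∈ v, i ≤ j) ∧ ¬ (i ∈ v ↔ i ∈ a) := by
    by_contra! hall
    refine ha ⟨a \ v, fun i hi j hj => ?_, ?_⟩
    · rw [Finset.mem_sdiff] at hj
      by_contra! hle
      exact hj.2 ((hall j ⟨i, hi, hle⟩).mpr hj.1)
    · rw [Finset.union_sdiff_of_subset fun i hi => (hall i ⟨i, hi, le_rfl⟩).mp hi]
  classical
  obtain ⟨⟨j, hj, hle⟩, hne⟩ := Nat.find_spec hex
  have hmin := fun i hi => Nat.find_min hex (m := i) hi
  set m := Nat.find hex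
  have hagree : ∀ i < m, (i ∈ v ↔ i ∈ a) := fun i hi => by
    have := hmin i hi
    by_contra hcon
    exact this ⟨⟨j, hj, hi.le.trans hle⟩, hcon⟩
  have hout : ∀ s : Finset ℕ, (∀ i ∈ v, ∀ j ∈ s, i < j) → ∀ i ≤ m, (i ∈ v ∪ s ↔ i ∈ v) := by
    intro s hs i hi
    have : i ∉ s := fun his => absurd (hs j hj i his) (not_lt.mpr (hi.trans hle))
    simp [this]
  by_cases hmv : m ∈ v
  · refine Or.inr fun s hs => ⟨m, by simp [hmv], by tauto, fun i hi => ?_⟩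
    rw [hout s hs i hi.le, hagree i hi]
  · refine Or.inl fun s hs => ⟨m, by tauto, by rwa [hout s hs m le_rfl], fun i hi => ?_⟩
    rw [hout s hs i hi.le, hagree i hi]

-- The order topology and the embedding of `F_v` into `F`

namespace LexFamily

variable {F : Set (Finset ℕ)}

theorem isOpen_Ioi (a : LexFamily F) : IsOpen {x : LexFamily F | LexLT a.1 x.1} :=
  TopologicalSpace.isOpen_generateFrom_of_mem ⟨a, Or.inl rfl⟩

theorem isOpen_Iio (a : LexFamily F) : IsOpen {x : LexFamily F | LexLT x.1 a.1} :=
  TopologicalSpace.isOpen_generateFrom_of_mem ⟨a, Or.inr rfl⟩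

instance (F : Set (Finset ℕ)) : T1Space (LexFamily F) := by
  refine t1Space_iff_exists_open.mpr fun x y hxy => ?_
  rcases LexLT.lt_or_lt (fun h => hxy (Subtype.ext h)) with h | h
  · exact ⟨_, isOpen_Iio y, h, LexLT.irrefl _⟩
  · exact ⟨_, isOpen_Ioi y, h, LexLT.irrefl _⟩

/-- The map `s ↦ v ∪ s` from `F_v` to `F`. -/
def extend (F : Set (Finset ℕ)) (v : Finset ℕ) (s : LexFamily (familyAt F v)) : LexFamily F :=
  ⟨v ∪ s.1, s.2.1⟩

theorem extend_injective (v : Finset ℕ) : Function.Injective (extend F v) := by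
  intro s t hst
  by_contra hne
  rcases LexLT.lt_or_lt (fun h => hne (Subtype.ext h)) with h | h
  · rw [← LexLT.union_left_iff s.2.2 t.2.2] at h
    exact LexLT.irrefl _ ((congrArg (LexLT · (v ∪ t.1)) (congrArg Subtype.val hst)).mp h)
  · rw [← LexLT.union_left_iff t.2.2 s.2.2] at h
    exact LexLT.irrefl _ ((congrArg (LexLT (v ∪ t.1) ·) (congrArg Subtype.val hst)).mp h)

/-- A ray whose endpoint extends `v` pulls back to a ray; any other endpoint lies on one side of all
extensions of `v`, so its rays pull back to everything or nothing. -/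
theorem continuous_extend (v : Finset ℕ) : Continuous (extend F v) := by
  refine continuous_generateFrom_iff.mpr ?_
  rintro _ ⟨a, h⟩
  by_cases ha : ∃ s, (∀ i ∈ v, ∀ j ∈ s, i < j) ∧ a.1 = v ∪ s
  · obtain ⟨s, hs, has⟩ := ha
    let b : LexFamily (familyAt F v) := ⟨s, has ▸ a.2, hs⟩
    rcases h with rfl | rfl
    · convert isOpen_Ioi b using 1
      ext x
      simp only [Set.mem_preimage, Set.mem_ofPred_eq, has]
      exact LexLT.union_left_iff hs x.2.2
    · convert isOpen_Iio b using 1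
      ext x
      simp only [Set.mem_preimage, Set.mem_ofPred_eq, has]
      exact LexLT.union_left_iff x.2.2 hs
  · rcases LexLT.compare_extensions ha with hc | hc <;> rcases h with rfl | rfl
    · convert isOpen_univ
      exact Set.eq_univ_of_forall fun x => hc x.1 x.2.2
    · convert isOpen_empty
      exact Set.eq_empty_of_forall_notMem fun x hx =>
        LexLT.irrefl _ (LexLT.trans hx (hc x.1 x.2.2))
    · convert isOpen_empty
      exact Set.eq_empty_of_forall_notMem fun x hx =>
        LexLT.irrefl _ (LexLT.trans hx (hc x.1 x.2.2))
    · convert isOpen_univ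
      exact Set.eq_univ_of_forall fun x => hc x.1 x.2.2

theorem isEmbedding_extend (v : Finset ℕ) : Topology.IsEmbedding (extend F v) := by
  refine ⟨⟨le_antisymm (continuous_extend v).le_induced ?_⟩, extend_injective v⟩
  refine le_generateFrom ?_
  rintro _ ⟨a, rfl | rfl⟩
  · refine ⟨_, isOpen_Ioi (extend F v a), ?_⟩
    ext x
    exact LexLT.union_left_iff a.2.2 x.2.2
  · refine ⟨_, isOpen_Iio (extend F v a), ?_⟩
    ext x
    exact LexLT.union_left_iff x.2.2 a.2.2

/-- Derived sets of `F_v ↾ (M / v)` embed into those of `F ↾ M`. -/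
theorem extend_mem_iteratedDerivedSet {M : Set ℕ} {v : Finset ℕ} (hv : (v : Set ℕ) ⊆ M)
    {δ : Ordinal} {x : LexFamily (familyAt F v)}
    (hx : x ∈ CantorBendixson.iteratedDerivedSet
      (familyRestrict (familyAt F v) (tailAfter M v)) δ) :
    extend F v x ∈ CantorBendixson.iteratedDerivedSet (familyRestrict F M) δ := by
  have hmaps : Set.MapsTo (extend F v) (familyRestrict (familyAt F v) (tailAfter M v))
      (familyRestrict F M) := fun s hs i hi =>
    (Finset.mem_union.mp hi).elim (fun hi => hv hi) fun hi => (hs hi).1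
  exact CantorBendixson.mapsTo_iteratedDerivedSet (continuous_extend v) (extend_injective v)
    hmaps δ hx

end LexFamily

-- Tails, and the points `t_n` as first points of blocks

theorem exists_tailAfter_Ici (n₀ : ℕ) (v : Finset ℕ) :
    ∃ n₁, tailAfter (Set.Ici n₀) v = Set.Ici n₁ := by
  refine ⟨n₀ ⊔ v.sup (· + 1), ?_⟩
  ext i
  simp [tailAfter]

theorem infinite_tailAfter {M : Set ℕ} (hM : M.Infinite) (v : Finset ℕ) :
    (tailAfter M v).Infinite := by
  refine (hM.sdiff (Set.finite_Iic (v.sup id))).mono fun i hi => ⟨hi.1, fun j hj => ?_⟩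
  exact (Finset.le_sup (f := id) hj).trans_lt (not_le.mp hi.2)

theorem tailAfter_mono {M S : Set ℕ} (h : M ⊆ S) (v : Finset ℕ) :
    tailAfter M v ⊆ tailAfter S v :=
  fun _ hi => ⟨h hi.1, hi.2⟩

namespace IsUniform

variable {α : Ordinal.{0}} {S : Set ℕ} {F : Set (Finset ℕ)}

theorem firstBlock_spec (h : IsUniform α S F) (hα : α ≠ 0) {n : ℕ} (hn : Set.Ici n ⊆ S) :
    firstBlock F n ∈ F ∧ IsInitialSegment (firstBlock F n) (Set.Ici n) := by
  refine Classical.epsilon_spec (p := fun t => t ∈ F ∧ IsInitialSegment t (Set.Ici n)) ?_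
  obtain ⟨t, ht, k, hk⟩ := h.exists_initial (Set.Ici_infinite n) hn
  obtain ⟨i, hi⟩ := (h.nonempty_and_subset hα ht).1
  have hik : i ∈ Set.Ici n ∩ Set.Iio k := by rw [← hk]; exact hi
  -- Passes from the strict bound `< k` to a weak one; `k > 0` because `t` is nonempty.
  refine ⟨t, ht, k - 1, ?_⟩
  rw [hk]
  ext j
  have : i < k := hik.2
  simp only [Set.mem_inter_iff, Set.mem_Ici, Set.mem_Iio, Set.mem_Iic]
  omega

theorem firstBlock_mem (h : IsUniform α S F) (hα : α ≠ 0) {n : ℕ} (hn : Set.Ici n ⊆ S) :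
    firstBlock F n ∈ F :=
  (h.firstBlock_spec hα hn).1

theorem le_of_mem_firstBlock (h : IsUniform α S F) (hα : α ≠ 0) {n : ℕ} (hn : Set.Ici n ⊆ S)
    {i : ℕ} (hi : i ∈ firstBlock F n) : n ≤ i := by
  obtain ⟨-, k, hk⟩ := h.firstBlock_spec hα hn
  have : i ∈ Set.Ici n ∩ Set.Iic k := by rw [← hk]; exact hi
  exact this.1

theorem self_mem_firstBlock (h : IsUniform α S F) (hα : α ≠ 0) {n : ℕ} (hn : Set.Ici n ⊆ S) :
    n ∈ firstBlock F n := by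
  obtain ⟨hmem, k, hk⟩ := h.firstBlock_spec hα hn
  obtain ⟨i, hi⟩ := (h.nonempty_and_subset hα hmem).1
  have hik : i ∈ Set.Ici n ∩ Set.Iic k := by rw [← hk]; exact hi
  have : n ∈ Set.Ici n ∩ Set.Iic k := ⟨Set.mem_Ici.mpr le_rfl,
    Set.mem_Iic.mpr (le_trans (Set.mem_Ici.mp hik.1) hik.2)⟩
  rw [← hk] at this
  exact this

/-- `t_n` is the `<_lex`-least member of `F` contained in `[n, ∞)`. -/
theorem not_lexLT_firstBlock (h : IsUniform α S F) (hα : α ≠ 0) {n : ℕ} (hn : Set.Ici n ⊆ S)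
    {a : Finset ℕ} (ha : a ∈ F) (han : ∀ i ∈ a, n ≤ i) : ¬ LexLT a (firstBlock F n) := by
  rintro ⟨m, hm, hmt, hlt⟩
  obtain ⟨hmem, k, hk⟩ := h.firstBlock_spec hα hn
  have hmk : k < m := by
    by_contra! hle
    have : m ∈ Set.Ici n ∩ Set.Iic k := ⟨han m hm, hle⟩
    rw [← hk] at this
    exact hmt this
  -- The deciding `m` lies beyond the end of `t_n`, so `t_n` is an initial segment of `a`, and
  -- members of `F` are not proper initial segments of one another.
  have heq : firstBlock F n = a := by
    refine h.eq_of_initial hmem ha (k := m) fun i => ⟨fun hi => ?_, fun hi => ?_⟩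
    · have : i ∈ Set.Ici n ∩ Set.Iic k := by rw [← hk]; exact hi
      have him : i < m := lt_of_le_of_lt this.2 hmk
      exact ⟨(hlt i him).mpr hi, him⟩
    · exact (hlt i hi.2).mp hi.1
  exact hmt (heq ▸ hm)

theorem lexLT_firstBlock (h : IsUniform α S F) (hα : α ≠ 0) {n : ℕ} (hn : Set.Ici n ⊆ S)
    {a : Finset ℕ} {j : ℕ} (hj : j ∈ a) (hjn : j < n) : LexLT a (firstBlock F n) := by
  have hne : a.Nonempty := ⟨j, hj⟩
  have hlt : a.min' hne < n := (a.min'_le j hj).trans_lt hjn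
  refine ⟨a.min' hne, a.min'_mem hne, fun hi => ?_, fun i hi => ?_⟩
  · exact absurd (h.le_of_mem_firstBlock hα hn hi) (not_le.mpr hlt)
  · constructor
    · exact fun hia => absurd (a.min'_le i hia) (not_le.mpr hi)
    · exact fun hit => absurd (h.le_of_mem_firstBlock hα hn hit) (not_le.mpr (hi.trans hlt))

/-- `t_{n+1}` is the limit of those members of `F` that start with `n` and have large second
element. -/
theorem mem_derivedSet_of_eq_firstBlock (h : IsUniform α S F) (hα : α ≠ 0) {n : ℕ}
    (hn : Set.Ici n ⊆ S) (hne : ∅ ∉ familyAt F {n}) {t : LexFamily F}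
    (ht : t.1 = firstBlock F (n + 1)) {C : Set (LexFamily F)}
    (hC : ∀ k, ∃ y : LexFamily (familyAt F {n}), (∀ i ∈ y.1, k ≤ i) ∧
      LexFamily.extend F {n} y ∈ C) :
    t ∈ derivedSet C := by
  have hn' : Set.Ici (n + 1) ⊆ S := fun i hi => hn (Nat.le_of_succ_le hi)
  choose y hy hyC using hC
  have hnt : n ∉ t.1 := fun hnt => by
    rw [ht] at hnt
    exact absurd (h.le_of_mem_firstBlock hα hn' hnt) (by simp)
  have hny : ∀ k, n ∈ (LexFamily.extend F {n} (y k)).1 := fun k => by simp [LexFamily.extend]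
  have hyt : ∀ k, LexLT (LexFamily.extend F {n} (y k)).1 t.1 := fun k => by
    rw [ht]
    exact h.lexLT_firstBlock hα hn' (hny k) n.lt_succ_self
  rw [mem_derivedSet, accPt_iff_frequently]
  have htend : Filter.Tendsto (fun k => LexFamily.extend F {n} (y k)) Filter.atTop (nhds t) := by
    refine TopologicalSpace.tendsto_nhds_generateFrom_iff.mpr ?_
    rintro _ ⟨a, rfl | rfl⟩ hta
    -- A lower endpoint `a < t_{n+1}` starts at or below `n`. If below, it precedes all members
    -- starting with `n`; otherwise second elements are compared.
    · have hex : ∃ i ∈ a.1, i < n + 1 := by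
        by_contra! hall
        rw [Set.mem_ofPred_eq, ht] at hta
        exact h.not_lexLT_firstBlock hα hn' a.2 hall hta
      obtain ⟨i₀, hi₀, hlt⟩ := hex
      by_cases hsmall : ∃ i ∈ a.1, i < n
      · refine Filter.Eventually.of_forall fun k => ?_
        have hane : a.1.Nonempty := ⟨i₀, hi₀⟩
        obtain ⟨i, hi, hin⟩ := hsmall
        have hmin := (a.1.min'_le i hi).trans_lt hin
        have hout : ∀ j < n, j ∉ (LexFamily.extend F {n} (y k)).1 := by
          intro j hj hmem
          rcases Finset.mem_union.mp hmem with hmem | hmem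
          · exact hj.ne (Finset.mem_singleton.mp hmem)
          · exact absurd ((y k).2.2 n (by simp) j hmem) hj.not_gt
        refine ⟨a.1.min' hane, a.1.min'_mem hane, hout _ hmin, fun j hj => ?_⟩
        exact ⟨fun hja => absurd (a.1.min'_le j hja) hj.not_ge,
          fun hjy => absurd hjy (hout j (hj.trans hmin))⟩
      · push Not at hsmall
        have hna : n ∈ a.1 := by
          have := hsmall i₀ hi₀
          have : i₀ = n := by omega
          exact this ▸ hi₀
        have hmem := mem_familyAt_singleton_erase a.2 hna hsmall
        -- `{n} ∉ F`, so `a` has a second element, and every `k` beyond it works.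
        have hne' : (a.1.erase n).Nonempty := by
          rw [Finset.nonempty_iff_ne_empty]
          intro h0
          exact hne (h0 ▸ hmem)
        have haeq : a.1 = {n} ∪ a.1.erase n := by
          rw [← Finset.insert_eq, Finset.insert_erase hna]
        filter_upwards [Filter.eventually_gt_atTop ((a.1.erase n).min' hne')] with k hk
        change LexLT a.1 ({n} ∪ (y k).1)
        rw [haeq, LexLT.union_left_iff hmem.2 (y k).2.2]
        refine ⟨_, Finset.min'_mem _ hne', fun hi => ?_, fun j hj => ?_⟩
        · exact absurd (hy k _ hi) hk.not_ge
        · exact ⟨fun hja => absurd (Finset.min'_le _ j hja) hj.not_ge,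
            fun hjy => absurd (hy k j hjy) (hj.trans hk).not_ge⟩
    · exact Filter.Eventually.of_forall fun k => (hyt k).trans hta
  refine htend.frequently (Filter.Frequently.of_forall fun k => ⟨fun heq => ?_, hyC k⟩)
  exact hnt (heq ▸ hny k)

-- Upper bound: the `α`-th derivative of `F` is empty

/-- An element starting with `n` whose Cantor–Bendixson rank is at least that of `F_{n}` is
`t_n`. -/
theorem eq_firstBlock_of_mem_iteratedDerivedSet (h : IsUniform α S F) (hα : α ≠ 0) {n : ℕ}
    (hn : Set.Ici n ⊆ S) {γ : Ordinal.{0}}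
    (hγ : IsUniform γ (tailAfter S {n}) (familyAt F {n}))
    (hempty : γ ≠ 0 → CantorBendixson.iteratedDerivedSet
      (Set.univ : Set (LexFamily (familyAt F {n}))) γ = ∅)
    {x : LexFamily F} (hnx : n ∈ x.1) (hmin : ∀ i ∈ x.1, n ≤ i)
    (hx : x ∈ CantorBendixson.iteratedDerivedSet Set.univ γ) : x.1 = firstBlock F n := by
  have hn' : Set.Ici (n + 1) ⊆ S := fun i hi => hn (Nat.le_of_succ_le hi)
  by_contra hne
  have hlt : LexLT (firstBlock F n) x.1 :=
    (LexLT.lt_or_lt hne).resolve_left (h.not_lexLT_firstBlock hα hn x.2 hmin)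
  let t : LexFamily F := ⟨firstBlock F n, h.firstBlock_mem hα hn⟩
  let t' : LexFamily F := ⟨firstBlock F (n + 1), h.firstBlock_mem hα hn'⟩
  let y : LexFamily (familyAt F {n}) := ⟨x.1.erase n, mem_familyAt_singleton_erase x.2 hnx hmin⟩
  have hextend : ∀ (z : LexFamily F) (hnz : n ∈ z.1) (hz : ∀ i ∈ z.1, n ≤ i),
      LexFamily.extend F {n} ⟨z.1.erase n, mem_familyAt_singleton_erase z.2 hnz hz⟩ = z := by
    intro z hnz hz
    refine Subtype.ext ?_
    change {n} ∪ z.1.erase n = z.1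
    rw [← Finset.insert_eq, Finset.insert_erase hnz]
  have hyx : LexFamily.extend F {n} y = x := hextend x hnx hmin
  have hy : y ∈ CantorBendixson.iteratedDerivedSet Set.univ γ := by
    -- The open interval `(t_n, t_{n+1})` contains `x` and only members starting with `n`.
    refine CantorBendixson.mem_iteratedDerivedSet_of_isEmbedding
      (LexFamily.isEmbedding_extend {n})
      ((LexFamily.isOpen_Ioi t).inter (LexFamily.isOpen_Iio t')) ?_ (B := Set.univ)
      (Set.subset_univ _) ?_ (by rwa [hyx])
    · rintro z ⟨⟨m, hmt, hmz, hagree⟩, hz'⟩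
      have hnm := h.le_of_mem_firstBlock hα hn hmt
      have hz : ∀ i ∈ z.1, n ≤ i := by
        intro i hi
        by_contra! hin
        exact absurd (h.le_of_mem_firstBlock hα hn ((hagree i (hin.trans_le hnm)).mpr hi))
          hin.not_ge
      have hnz : n ∈ z.1 := by
        by_contra hnz
        refine h.not_lexLT_firstBlock hα hn' z.2 (fun i hi => ?_) hz'
        exact lt_of_le_of_ne (hz i hi) fun heq => hnz (heq ▸ hi)
      exact ⟨_, hextend z hnz hz⟩
    · rw [hyx]
      exact ⟨hlt, h.lexLT_firstBlock hα hn' hnx n.lt_succ_self⟩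
  -- At rank `0` the section is `{∅}`, whose `0`-th derivative is not empty; instead `{n}` is the
  -- only member starting with `n`.
  by_cases hγ0 : γ = 0
  · rcases hγ.eq_zero_or_sections with ⟨-, hF⟩ | ⟨-, a, -, -, ha, -⟩
    · have hE : ∀ z ∈ F, n ∈ z → (∀ i ∈ z, n ≤ i) → z = {n} := by
        intro z hz hnz hzmin
        have h0 := mem_familyAt_singleton_erase hz hnz hzmin
        rw [hF, Set.mem_singleton_iff] at h0
        rw [← Finset.insert_erase hnz, h0]
        rfl
      exact hne ((hE _ x.2 hnx hmin).trans (hE _ t.2 (h.self_mem_firstBlock hα hn)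
        fun i hi => h.le_of_mem_firstBlock hα hn hi).symm)
    · obtain ⟨m, hm⟩ := hγ.infinite.nonempty
      exact absurd (ha m hm) (by simp [hγ0])
  · rw [hempty hγ0] at hy
    exact hy

theorem iteratedDerivedSet_univ_eq_empty {n₀ : ℕ} (h : IsUniform α (Set.Ici n₀) F)
    (hα : α ≠ 0) :
    CantorBendixson.iteratedDerivedSet (Set.univ : Set (LexFamily F)) α = ∅ := by
  induction α using WellFoundedLT.induction generalizing n₀ F with
  | _ α ih =>
    rcases h.eq_zero_or_sections with ⟨h0, -⟩ | ⟨hF, a, ha, hmono, hlt, -⟩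
    · exact absurd h0 hα
    have hblock : ∀ (x : LexFamily F) (n : ℕ), n ∈ x.1 → (∀ i ∈ x.1, n ≤ i) →
        x ∈ CantorBendixson.iteratedDerivedSet Set.univ (a n) → x.1 = firstBlock F n := by
      intro x n hnx hmin hx
      have hnS : n ∈ Set.Ici n₀ := (hF x.1 x.2).2 hnx
      obtain ⟨n₁, hn₁⟩ := exists_tailAfter_Ici n₀ {n}
      refine h.eq_firstBlock_of_mem_iteratedDerivedSet hα (Set.Ici_subset_Ici.mpr hnS) (ha n hnS)
        (fun h0 => ?_) hnx hmin hx
      have := ha n hnS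
      rw [hn₁] at this
      exact ih (a n) (hlt n hnS) this h0
    refine Set.eq_empty_of_forall_notMem fun x hx => ?_
    obtain ⟨hne, hxS⟩ := hF x.1 x.2
    have hnx : x.1.min' hne ∈ x.1 := x.1.min'_mem hne
    set n := x.1.min' hne
    have hnS : n ∈ Set.Ici n₀ := hxS hnx
    have hn' : Set.Ici (n + 1) ⊆ Set.Ici n₀ :=
      Set.Ici_subset_Ici.mpr (le_trans hnS (Nat.le_succ n))
    let t' : LexFamily F := ⟨firstBlock F (n + 1), h.firstBlock_mem hα hn'⟩
    have hx' := CantorBendixson.iteratedDerivedSet_antitone _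
      (Order.add_one_le_of_lt (hlt n hnS)) hx
    rw [CantorBendixson.iteratedDerivedSet_succ] at hx'
    have hacc : AccPt x (Filter.principal (CantorBendixson.iteratedDerivedSet Set.univ (a n))) :=
      hx'.1
    have hinf := Set.Infinite.of_accPt <| hacc.nhds_inter ((LexFamily.isOpen_Iio t').mem_nhds
      (h.lexLT_firstBlock hα hn' hnx n.lt_succ_self))
    refine hinf ?_
    refine Set.Finite.of_finite_image (f := Subtype.val) ?_ Subtype.val_injective.injOn
    -- A point below `t_{n+1}` starts with some `m ≤ n`; as `a m ≤ a n`, surviving to stage `a n`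
    -- forces it to be `t_m`.
    refine ((Set.finite_Iic n).image (firstBlock F)).subset ?_
    rintro _ ⟨z, ⟨hzt, hz⟩, rfl⟩
    obtain ⟨hzne, hzS⟩ := hF z.1 z.2
    have hle : z.1.min' hzne ≤ n := by
      by_contra! hgt
      exact h.not_lexLT_firstBlock hα hn' z.2
        (fun i hi => Nat.succ_le_of_lt (hgt.trans_le (z.1.min'_le i hi))) hzt
    refine ⟨z.1.min' hzne, hle, (hblock z _ (z.1.min'_mem hzne)
      (fun i hi => z.1.min'_le i hi) ?_).symm⟩
    exact CantorBendixson.iteratedDerivedSet_antitone _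
      (hmono (hzS (z.1.min'_mem hzne)) hnS hle) hz

end IsUniform

-- Lower bound from adequacy

/-- Lower bound for the Cantor–Bendixson derivatives of `F ↾ M`, jointly with the position of the
points `t_{n+1}`. -/
theorem IsAdequate.nonempty_and_exists_firstBlock {α : Ordinal.{0}} {n₀ : ℕ}
    {F : Set (Finset ℕ)} {M : Set ℕ} (hα : 2 ≤ α) (hF : IsUniform α (Set.Ici n₀) F)
    (hMS : M ⊆ Set.Ici n₀) (hM : M.Infinite) (hMF : IsAdequate α (Set.Ici n₀) F M) :
    (∀ δ < α, (CantorBendixson.iteratedDerivedSet (familyRestrict F M) δ).Nonempty) ∧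
      ∀ β : Ordinal.{0}, α = β + 1 → ∀ n ∈ adequateCore α (Set.Ici n₀) F M,
        ∃ t ∈ CantorBendixson.iteratedDerivedSet (familyRestrict F M) β,
          t.1 = firstBlock F (n + 1) := by
  induction α using WellFoundedLT.induction generalizing n₀ F M with
  | _ α ih =>
    have hα0 : α ≠ 0 := fun h => by simp [h] at hα
    have hcore : ∀ β : Ordinal.{0}, α = β + 1 → ∀ n ∈ adequateCore α (Set.Ici n₀) F M,
        ∃ t ∈ CantorBendixson.iteratedDerivedSet (familyRestrict F M) β,
          t.1 = firstBlock F (n + 1) := by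
      rintro β rfl n hn
      have hβ0 : β ≠ 0 := by
        rintro rfl
        simp at hα
      have hnM : n ∈ M := by
        rw [adequateCore] at hn
        exact hn.1
      have hnS : Set.Ici n ⊆ Set.Ici n₀ := Set.Ici_subset_Ici.mpr (hMS hnM)
      have hn' : Set.Ici (n + 1) ⊆ Set.Ici n₀ := fun i hi => hnS (Nat.le_of_succ_le hi)
      have hFn := hF.section_of_add_one (hMS hnM)
      have hnMsub : (({n} : Finset ℕ) : Set ℕ) ⊆ M := by simpa using hnM
      obtain ⟨n₁, hn₁⟩ := exists_tailAfter_Ici n₀ {n}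
      have hMn : tailAfter M {n} ⊆ Set.Ici n₁ := hn₁ ▸ tailAfter_mono hMS {n}
      have hMninf := infinite_tailAfter hM {n}
      -- Surviving points of `F_{n} ↾ (M / n)` arbitrarily far out, with `n` prepended, converge to
      -- `t_{n+1}`.
      suffices hsuff : (firstBlock F (n + 1) : Set ℕ) ⊆ M ∧
          ∀ δ < β, ∀ k, ∃ y : LexFamily (familyAt F {n}), (∀ i ∈ y.1, k ≤ i) ∧
            y ∈ CantorBendixson.iteratedDerivedSet
              (familyRestrict (familyAt F {n}) (tailAfter M {n})) δ by
        refine ⟨⟨_, hF.firstBlock_mem hα0 hn'⟩, ?_, rfl⟩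
        refine CantorBendixson.mem_iteratedDerivedSet_of_forall_lt hsuff.1 fun δ hδ => ?_
        refine hF.mem_derivedSet_of_eq_firstBlock hα0 hnS
          (fun h => Finset.not_nonempty_empty (hFn.nonempty_and_subset hβ0 h).1) rfl fun k => ?_
        obtain ⟨y, hyk, hy⟩ := hsuff.2 δ hδ k
        exact ⟨y, hyk, LexFamily.extend_mem_iteratedDerivedSet hnMsub hy⟩
      rw [adequateCore] at hn
      rcases hn.2 with ⟨h2, hsub⟩ | ⟨β', hβ', hβ2, hsub, had, hinf⟩ | hlim
      · refine ⟨hsub, fun δ hδ k => ?_⟩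
        -- Here `F_{n}` has rank `1`, so its members within `M / n` include all singletons `{m}`,
        -- and only `δ = 0` is required.
        have hβ1 : β = 0 + 1 := by
          have : (β + 1 : Ordinal.{0}) = 1 + 1 := by rw [h2, one_add_one_eq_two]
          simpa using this
        have hδ0 : δ = 0 := by
          rw [hβ1] at hδ
          simpa using hδ
        rw [hβ1] at hFn
        obtain ⟨m, hm, hkm⟩ := hMninf.exists_gt k
        have hmem := hFn.section_of_add_one (tailAfter_mono hMS {n} hm)
        rcases hmem.eq_zero_or_sections with ⟨-, hE⟩ | ⟨-, a, -, -, ha, -⟩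
        · have hm' : ({m} : Finset ℕ) ∈ familyAt F {n} := by
            have : (∅ : Finset ℕ) ∈ familyAt (familyAt F {n}) {m} := by
              rw [hE]
              rfl
            simpa using this.1
          refine ⟨⟨{m}, hm'⟩, by simpa using hkm.le, ?_⟩
          rw [hδ0, CantorBendixson.iteratedDerivedSet_zero]
          intro i hi
          rw [Finset.coe_singleton, Set.mem_singleton_iff] at hi
          exact hi ▸ hm
        · obtain ⟨j, hj⟩ := hmem.infinite.nonempty
          exact absurd (ha j hj) (by simp)
      · refine ⟨hsub, ?_⟩
        obtain rfl : β = β' := by simpa using hβ'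
        rw [hn₁] at had hinf hFn
        have hlt : β < β + 1 := Order.lt_add_one_iff.mpr le_rfl
        have hind := ih β hlt hβ2 hFn hMn hMninf had
        intro δ hδ k
        rw [IsAdequate] at had
        rcases had with ⟨⟨γ, rfl, -⟩, -⟩ | ⟨hlim, a, ha, hlub, hau, hv⟩
        -- Infinitude of `(M / n)(F_{n})` gives the surviving points `t_{j+1}` of `F_{n}` with `j >
        -- k`.
        · obtain ⟨j, hj, hkj⟩ := hinf.exists_gt k
          obtain ⟨y, hy, hyj⟩ := hind.2 γ rfl j hj
          have hjM : j ∈ tailAfter M {n} := by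
            rw [adequateCore] at hj
            exact hj.1
          refine ⟨y, fun i hi => ?_, CantorBendixson.iteratedDerivedSet_antitone _
            (Order.lt_add_one_iff.mp hδ) hy⟩
          rw [hyj] at hi
          have := hFn.le_of_mem_firstBlock hβ0
            (Set.Ici_subset_Ici.mpr ((Set.mem_Ici.mp (hMn hjM)).trans j.le_succ)) hi
          omega
        · obtain ⟨_, ⟨m, hm, rfl⟩, hδm⟩ := (lt_isLUB_iff hlub).mp hδ
          -- Index `m` makes the rank of the section exceed `δ`; index `k` forces `v` to lie in `[k,
          -- ∞)`.
          have hmax : max m k ∈ Set.Ici n₁ :=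
            Set.mem_Ici.mpr (le_max_of_le_left (Set.mem_Ici.mp hm))
          obtain ⟨v, hvne, hvM, γ, hγβ, haγ, hγ2, hγ, hvad⟩ := hv _ hmax
          have hvS : (v : Set ℕ) ⊆ Set.Ici n₁ := hvM.trans hMn
          have hvm := le_of_rank_familyAt ha hau hvS hγ hmax haγ
          obtain ⟨n₂, hn₂⟩ := exists_tailAfter_Ici n₁ v
          have hsub₂ := tailAfter_mono hMn v
          rw [hn₂] at hγ hvad hsub₂
          have hδγ : δ < γ :=
            hδm.trans_le ((ha.monotoneOn hm hmax (le_max_left m k)).trans haγ)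
          obtain ⟨y, hy⟩ := (ih γ (hγβ.trans hlt) hγ2 hγ hsub₂
            (infinite_tailAfter hMninf v) hvad).1 δ hδγ
          refine ⟨_, fun i hi => ?_, LexFamily.extend_mem_iteratedDerivedSet hvM hy⟩
          rcases Finset.mem_union.mp hi with hi | hi
          · exact (le_max_right m k).trans (hvm i hi)
          · obtain ⟨j, hj⟩ := hvne
            exact ((le_max_right m k).trans (hvm j hj)).trans (y.2.2 j hj i hi).le
      · exact absurd hlim (Order.not_isSuccLimit_add_one β)
    refine ⟨fun δ hδ => ?_, hcore⟩
    rw [IsAdequate] at hMF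
    rcases hMF with ⟨⟨β, hβ, -⟩, n, hn⟩ | ⟨-, a, ha, hlub, hau, hv⟩
    · obtain ⟨t, ht, -⟩ := hcore β hβ n hn
      rw [hβ] at hδ
      exact ⟨t, CantorBendixson.iteratedDerivedSet_antitone _ (Order.lt_add_one_iff.mp hδ) ht⟩
    · obtain ⟨_, ⟨m, hm, rfl⟩, hδm⟩ := (lt_isLUB_iff hlub).mp hδ
      obtain ⟨v, -, hvM, γ, hγα, haγ, hγ2, hγ, hvad⟩ := hv m hm
      obtain ⟨n₂, hn₂⟩ := exists_tailAfter_Ici n₀ v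
      have hsub₂ := tailAfter_mono hMS v
      rw [hn₂] at hγ hvad hsub₂
      obtain ⟨y, hy⟩ := (ih γ hγα hγ2 hγ hsub₂ (infinite_tailAfter hM v) hvad).1 δ
        (hδm.trans_le haγ)
      exact ⟨_, LexFamily.extend_mem_iteratedDerivedSet hvM hy⟩

theorem mainTheorem1 (α : Ordinal.{0}) (hα : 2 ≤ α)
    (S : Set ℕ) (hS : ∃ n₀ : ℕ, S = Set.Ici n₀)
    (F : Set (Finset ℕ)) (hF : IsUniform α S F)
    (M : Set ℕ) (hMS : M ⊆ S) (hM : M.Infinite) (hMF : IsAdequate α S F M) :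
    IsCBIndex (familyRestrict F M) α ∧
      ∀ β : Ordinal.{0}, α = β + 1 → ∀ n ∈ adequateCore α S F M,
        ∃ t ∈ CantorBendixson.iteratedDerivedSet (familyRestrict F M) β,
          t.1 = firstBlock F (n + 1) := by
  obtain ⟨n₀, rfl⟩ := hS
  have hα0 : α ≠ 0 := fun h => by simp [h] at hα
  obtain ⟨hne, hcore⟩ := hMF.nonempty_and_exists_firstBlock hα hF hMS hM
  refine ⟨isCBIndex_of_nonempty_of_eq_empty hne (Set.subset_empty_iff.mp ?_), hcore⟩
  rw [← hF.iteratedDerivedSet_univ_eq_empty hα0]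
  exact CantorBendixson.iteratedDerivedSet_mono (Set.subset_univ _) α
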